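/- Let $(a;b)_\infty=\prod_{k\ge 0}(1-ab^k)$ and $\psi(q)=\sum_{n\ge 0}q^{n(n+1)/2}$, and define the integers $\mathrm{pod}_{-3}(n)$ by $$\sum_{n\ge 0}\mathrm{pod}_{-3}(n)\,q^n=\frac{(-q;q^2)_\infty^3}{(q^2;q^2)_\infty^3}.$$ A congruence modulo $9$ between formal power series in $q$ with integer coefficients means that all corresponding coefficients are congruent modulo $9$. Then for every integer $\alpha\ge 1$, $$\sum_{n\ge 0}(-1)^n\,\mathrm{pod}_{-3}\!\left(3^{2\alpha}n+\frac{5\cdot 3^{2\alpha}+3}{8}\right)q^n\equiv(-1)^{\alpha-1}\,\frac{\psi(q^3)^4}{\psi(q)^7}\pmod 9$$ and $$\sum_{n\ge 0}(-1)^n\,\mathrm{pod}_{-3}\!\left(3^{2\alpha+1}n+\frac{7\cdot 3^{2\alpha+1}+3}{8}\right)q^n\equiv(-1)^{\alpha-1}\,\frac{\psi(q^3)^5}{\psi(q)^8}\pmod 9.$$ -/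

import Mathlib

open scoped PowerSeries.WithPiTopology

noncomputable section

/-- The q-shifted factorial `(a; b)_∞ = ∏_{k ≥ 0} (1 - a b ^ k)`, as an infinite product of formal
power series over `ℤ` (coefficientwise convergence, `ℤ` being discrete). -/
def qPoch (a b : PowerSeries ℤ) : PowerSeries ℤ :=
  ∏' k : ℕ, (1 - a * b ^ k)

/-- Ramanujan's theta function `ψ(Q) = ∑_{n ≥ 0} Q ^ (n(n+1)/2)`, evaluated at a formal power
series `Q` (with zero constant term) such as `q` or `q ^ 3`. -/
def psi (Q : PowerSeries ℤ) : PowerSeries ℤ :=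
  ∑' n : ℕ, Q ^ (n * (n + 1) / 2)

/-- The reciprocal `1 / f` of a formal power series with constant term `1`. -/
def recip (f : PowerSeries ℤ) : PowerSeries ℤ :=
  PowerSeries.invOfUnit f 1

/-- `podNeg k n` is `pod_{-k}(n)`, defined by its generating function: the coefficient of `q ^ n` in
`(-q; q²)_∞ ^ k / (q²; q²)_∞ ^ k`. -/
def podNeg (k n : ℕ) : ℤ :=
  PowerSeries.coeff n
    (qPoch (-PowerSeries.X) (PowerSeries.X ^ 2) ^ k *
      recip (qPoch (PowerSeries.X ^ 2) (PowerSeries.X ^ 2) ^ k))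

/-- Congruence of formal power series modulo `m`: all coefficients are congruent modulo `m`. -/
def SeriesModEq (m : ℤ) (f g : PowerSeries ℤ) : Prop :=
  ∀ n : ℕ, PowerSeries.coeff n f ≡ PowerSeries.coeff n g [ZMOD m]

/-- The infinite product `(a; b)_∞` converges when `b` has zero constant term. -/
theorem qPoch_multipliable (a b : PowerSeries ℤ) (hb : PowerSeries.constantCoeff b = 0) :
    Multipliable fun k : ℕ => (1 - a * b ^ k) := by
  simp_rw [sub_eq_add_neg]
  apply PowerSeries.WithPiTopology.multipliable_one_add_of_tendsto_order_atTop_nhds_top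
  refine ENat.tendsto_nhds_top_iff_natCast_lt.mpr fun n => Filter.eventually_atTop.mpr
    ⟨n + 1, fun k hk => ?_⟩
  rw [PowerSeries.order_neg]
  calc (n : ℕ∞) < (k : ℕ∞) := by exact_mod_cast hk
    _ ≤ (b ^ k).order := PowerSeries.le_order_pow_of_constantCoeff_eq_zero k hb
    _ ≤ a.order + (b ^ k).order := le_add_self
    _ ≤ _ := PowerSeries.le_order_mul _ _

/-- The series `ψ(Q)` converges when `Q` has zero constant term. -/
theorem psi_summable (Q : PowerSeries ℤ) (hQ : PowerSeries.constantCoeff Q = 0) :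
    Summable fun n : ℕ => Q ^ (n * (n + 1) / 2) := by
  apply PowerSeries.WithPiTopology.summable_of_tendsto_order_atTop_nhds_top
  refine ENat.tendsto_nhds_top_iff_natCast_lt.mpr fun n => Filter.eventually_atTop.mpr
    ⟨n + 1, fun k hk => ?_⟩
  have h : n < k * (k + 1) / 2 := by
    have : 2 * k ≤ k * (k + 1) := by nlinarith
    omega
  exact lt_of_lt_of_le (by exact_mod_cast h)
    (PowerSeries.le_order_pow_of_constantCoeff_eq_zero _ hQ)

/-- `(a; b)_∞` has constant term `1` when `a` and `b` have zero constant term. -/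
theorem qPoch_constantCoeff (a b : PowerSeries ℤ) (ha : PowerSeries.constantCoeff a = 0)
    (hb : PowerSeries.constantCoeff b = 0) :
    PowerSeries.constantCoeff (qPoch a b) = 1 := by
  have h := (qPoch_multipliable a b hb).map_tprod (PowerSeries.constantCoeff (R := ℤ))
    (PowerSeries.WithPiTopology.continuous_constantCoeff ℤ)
  rw [qPoch, h]
  simp [ha]

/-- `ψ(Q)` has constant term `1` when `Q` has zero constant term. -/
theorem psi_constantCoeff (Q : PowerSeries ℤ) (hQ : PowerSeries.constantCoeff Q = 0) :
    PowerSeries.constantCoeff (psi Q) = 1 := by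
  have h := (psi_summable Q hQ).map_tsum (PowerSeries.constantCoeff (R := ℤ))
    (PowerSeries.WithPiTopology.continuous_constantCoeff ℤ)
  rw [psi, h, tsum_eq_single 0]
  · simp
  · intro n hn
    have h2 : n * (n + 1) / 2 ≠ 0 := by
      have : 2 * n ≤ n * (n + 1) := by
        have : 1 ≤ n := Nat.one_le_iff_ne_zero.mpr hn
        nlinarith
      omega
    simp [hQ, h2]

/-- `recip f` is the inverse of `f` when `f` has constant term `1`. -/
theorem mul_recip (f : PowerSeries ℤ) (hf : PowerSeries.constantCoeff f = 1) :
    f * recip f = 1 :=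
  PowerSeries.mul_invOfUnit f 1 (by simpa using hf)

end

/-! By q ↦ -q and Gauss's product ψ(q) = (q²;q²)_∞/(q;q²)_∞, the numbers (-1)^n pod₋₃(n) are the
coefficients of 1/ψ(q)³, so the claim concerns iterated 3-dissections of that series.

Write ψ(q) = a(q³) + q b(q³) with b(q) = ψ(q³). A norm over the cube roots of unity gives F = a³ + q
b³ = ψ(q)⁴/ψ(q³) (`residuePart_psi_cubic`), hence 1/ψ(q) = (a² - q ab + q² b²)/F with a, b, F taken
at q³ (`recip_psi_dissection`). For the powers 3, 4, 7, 8 of 1/ψ, the residue part needed is a power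
of b times a power of 1/F times a binary form in a³ and q b³; modulo 9 that form is a power of F,
and everything collapses to powers of ψ(q³) and 1/ψ(q).

Factors in q³ pass through a residue part, so two extractions lead from ψ⁻³ to ψ(q³)⁴/ψ⁷. The cycle
ψ(q³)⁴/ψ⁷ → ψ(q³)⁵/ψ⁸ → ψ(q³)⁴/ψ⁷ is then the induction on α. -/

open PowerSeries Finset Filter Topology

/-! ### Gauss's product for ψ -/

/-- Shanks' finite form of Gauss's identity for `ψ`. -/
theorem shanks_identity {R : Type*} [CommRing R] (q : R) (n : ℕ) :
    ∑ s ∈ range n, (∏ k ∈ Ico s n, (1 - q ^ (2 * k + 2))) *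
        (∏ k ∈ range s, (1 - q ^ (2 * k + 1))) * q ^ (s * (2 * n + 1)) =
      (∏ k ∈ range n, (1 - q ^ (2 * k + 1))) * ∑ s ∈ range (2 * n), q ^ (s * (s + 1) / 2) := by
  induction n with
  | zero => simp
  | succ n ih =>
    have htri₁ : 2 * n * (2 * n + 1) / 2 = n * (2 * n + 1) := by
      rw [mul_assoc, Nat.mul_div_cancel_left _ two_pos]
    have htri₂ : (2 * n + 1) * (2 * n + 1 + 1) / 2 = n * (2 * n + 1) + (2 * n + 1) := by
      rw [show (2 * n + 1) * (2 * n + 1 + 1) = 2 * (n * (2 * n + 1) + (2 * n + 1)) by ring,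
        Nat.mul_div_cancel_left _ two_pos]
    -- The change from n to n + 1 telescopes in s; the factor 1 - q^(2s) kills the boundary term at
    -- s = 0.
    have htel : ∑ s ∈ range n, ((∏ k ∈ Ico s (n + 1), (1 - q ^ (2 * k + 2))) *
          (∏ k ∈ range s, (1 - q ^ (2 * k + 1))) * q ^ (s * (2 * (n + 1) + 1)) -
        (1 - q ^ (2 * n + 1)) * ((∏ k ∈ Ico s n, (1 - q ^ (2 * k + 2))) *
          (∏ k ∈ range s, (1 - q ^ (2 * k + 1))) * q ^ (s * (2 * n + 1)))) =
        (1 - q ^ (2 * n)) * (∏ k ∈ range n, (1 - q ^ (2 * k + 1))) * q ^ (n * (2 * n + 1)) := by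
      have h := sum_range_sub (fun s => (1 - q ^ (2 * s)) * (∏ k ∈ Ico s n, (1 - q ^ (2 * k + 2))) *
          (∏ k ∈ range s, (1 - q ^ (2 * k + 1))) * q ^ (s * (2 * n + 1))) n
      simp only [Ico_self, prod_empty, mul_one, mul_zero, pow_zero, sub_self, zero_mul,
        sub_zero] at h
      rw [← h]
      refine sum_congr rfl fun s hs => ?_
      have hs' : s < n := mem_range.1 hs
      rw [prod_Ico_succ_top hs'.le, prod_eq_prod_Ico_succ_bot hs', prod_range_succ]
      ring
    rw [sum_sub_distrib, ← mul_sum, ih] at htel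
    rw [sum_range_succ, eq_add_of_sub_eq htel, Nat.Ico_succ_singleton, prod_singleton,
      show 2 * (n + 1) = 2 * n + 1 + 1 by ring, sum_range_succ _ (2 * n + 1),
      sum_range_succ _ (2 * n), htri₁, htri₂, prod_range_succ]
    ring

theorem continuous_of_continuous_coeff {α : Type*} [TopologicalSpace α] {f : α → ℤ⟦X⟧}
    (h : ∀ n, Continuous fun a => coeff n (f a)) : Continuous f :=
  continuous_iff_continuousAt.2 fun _ =>
    (WithPiTopology.tendsto_iff_coeff_tendsto _ _ _ _).2 fun n => (h n).continuousAt

theorem tendsto_X_pow_mul_zero (f : ℕ → ℤ⟦X⟧) :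
    Tendsto (fun n => X ^ n * f n) atTop (𝓝 0) := by
  refine (WithPiTopology.tendsto_iff_coeff_tendsto _ _ _ _).2 fun d => ?_
  refine tendsto_const_nhds.congr' ?_
  filter_upwards [eventually_gt_atTop d] with n hn
  rw [coeff_X_pow_mul', if_neg (by omega), map_zero]

/-- Gauss's product formula for `ψ`. -/
theorem psi_mul_qPoch : psi X * qPoch X (X ^ 2) = qPoch (X ^ 2) (X ^ 2) := by
  have hX : constantCoeff (X ^ 2 : ℤ⟦X⟧) = 0 := by simp
  have hD := (qPoch_multipliable X (X ^ 2) hX).hasProd.tendsto_prod_nat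
  have hE := (qPoch_multipliable (X ^ 2) (X ^ 2) hX).hasProd.tendsto_prod_nat
  have hS := ((psi_summable X (by simp)).hasSum.tendsto_sum_nat).comp
    (tendsto_id.const_mul_atTop' (two_pos : 0 < 2))
  -- In Shanks' sum every term with s ≥ 1 is divisible by q^n, so only s = 0 survives in the limit.
  have hrem := tendsto_X_pow_mul_zero fun n => ∑ s ∈ range n,
    (∏ k ∈ Ico (s + 1) (n + 1), (1 - X ^ (2 * k + 2))) *
      (∏ k ∈ range (s + 1), (1 - X ^ (2 * k + 1))) * X ^ (s * (2 * n + 3) + n + 3)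
  refine tendsto_nhds_unique (hS.mul hD) ?_
  have hlim := (hE.comp (tendsto_add_atTop_nat 1)).add hrem
  rw [add_zero] at hlim
  refine (tendsto_add_atTop_iff_nat 1).1 (hlim.congr fun n => ?_)
  have h := shanks_identity (X : ℤ⟦X⟧) (n + 1)
  rw [sum_range_succ'] at h
  simp only [Function.comp_apply, id_eq]
  simp only [← pow_mul, ← pow_succ', ← pow_add, show ∀ k, 2 + 2 * k = 2 * k + 2 from
    fun k => add_comm _ _]
  rw [mul_comm (∑ _ ∈ _, _), ← h, zero_mul, pow_zero, mul_one, range_zero, prod_empty, mul_one,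
    range_eq_Ico, add_comm, mul_sum, range_eq_Ico]
  refine congrArg (· + _) (sum_congr rfl fun s _ => ?_)
  rw [show (s + 1) * (2 * (n + 1) + 1) = n + (s * (2 * n + 3) + n + 3) by ring,
    pow_add X n]
  ring

/-! ### Dissection modulo 3 -/

/-- The substitution `q ↦ q ^ 3`. -/
noncomputable abbrev expandThree : ℤ⟦X⟧ →ₐ[ℤ] ℤ⟦X⟧ := expand 3 three_ne_zero

/-- The series `∑ aₙ q ^ n ↦ ∑ a₃ₙ₊ᵣ q ^ n`. -/
noncomputable def residuePart (r : ℕ) : ℤ⟦X⟧ →+ ℤ⟦X⟧ where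
  toFun f := mk fun n => coeff (3 * n + r) f
  map_zero' := by ext; simp
  map_add' f g := by ext; simp

@[simp]
theorem coeff_residuePart (r n : ℕ) (f : ℤ⟦X⟧) :
    coeff n (residuePart r f) = coeff (3 * n + r) f := by
  simp [residuePart]

theorem continuous_residuePart (r : ℕ) : Continuous (residuePart r) :=
  continuous_of_continuous_coeff fun n => by
    simpa using WithPiTopology.continuous_coeff ℤ (3 * n + r)

theorem continuous_expandThree : Continuous expandThree :=
  continuous_of_continuous_coeff fun n => by
    simp only [coeff_expand]
    split_ifs
    · exact WithPiTopology.continuous_coeff ℤ _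
    · exact continuous_const

theorem residuePart_X_pow {r : ℕ} (hr : r < 3) (m : ℕ) :
    residuePart r (X ^ m) = if m % 3 = r then X ^ (m / 3) else 0 := by
  ext n
  rw [coeff_residuePart, coeff_X_pow]
  split_ifs with h₁ h₂ h₂
  · rw [coeff_X_pow, if_pos (by omega)]
  · omega
  · rw [coeff_X_pow, if_neg (by omega)]
  · simp

theorem residuePart_X_pow_mul_expandThree {r s : ℕ} (hr : r < 3) (hs : s < 3) (f : ℤ⟦X⟧) :
    residuePart r (X ^ s * expandThree f) = if r = s then f else 0 := by
  ext n
  rw [coeff_residuePart, coeff_X_pow_mul', coeff_expand]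
  split_ifs with h₁ h₂ h₃ h₃ h₃
  · congr 2
    omega
  · omega
  · omega
  · simp
  · omega
  · simp

/-- The dissection of a series according to its exponents modulo `3`. -/
theorem residuePart_dissection (f : ℤ⟦X⟧) :
    f = X ^ 0 * expandThree (residuePart 0 f) + X ^ 1 * expandThree (residuePart 1 f) +
      X ^ 2 * expandThree (residuePart 2 f) := by
  ext n
  simp only [map_add, coeff_X_pow_mul', coeff_expand, coeff_residuePart]
  obtain ⟨k, rfl | rfl | rfl⟩ : ∃ k, n = 3 * k ∨ n = 3 * k + 1 ∨ n = 3 * k + 2 :=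
    ⟨n / 3, by omega⟩
  · rw [if_pos (by omega), if_pos (by omega), Nat.sub_zero, Nat.mul_div_cancel_left _ three_pos]
    split_ifs <;> first | omega | simp
  · rw [if_pos (by omega), if_neg (by omega), if_pos (by omega), if_pos (by omega),
      Nat.add_sub_cancel, Nat.mul_div_cancel_left _ three_pos]
    split_ifs <;> omega
  · rw [if_pos (by omega), if_neg (by omega), if_pos (by omega), if_neg (by omega),
      if_pos (by omega), if_pos (by omega), Nat.add_sub_cancel,
      Nat.mul_div_cancel_left _ three_pos]
    simp

theorem residuePart_of_eq {f a b c : ℤ⟦X⟧} {r : ℕ} (hr : r < 3)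
    (h : f = expandThree a + X * expandThree b + X ^ 2 * expandThree c) :
    residuePart r f = (if r = 0 then a else 0) + (if r = 1 then b else 0) +
      (if r = 2 then c else 0) := by
  have h' : f = X ^ 0 * expandThree a + X ^ 1 * expandThree b + X ^ 2 * expandThree c := by
    rw [h, pow_zero, one_mul, pow_one]
  rw [h', map_add, map_add, residuePart_X_pow_mul_expandThree hr (by norm_num),
    residuePart_X_pow_mul_expandThree hr (by norm_num),
    residuePart_X_pow_mul_expandThree hr (by norm_num)]

theorem residuePart_expandThree_mul {r : ℕ} (hr : r < 3) (g f : ℤ⟦X⟧) :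
    residuePart r (expandThree g * f) = g * residuePart r f := by
  have h : expandThree g * f = expandThree (g * residuePart 0 f) +
      X * expandThree (g * residuePart 1 f) + X ^ 2 * expandThree (g * residuePart 2 f) := by
    conv_lhs => rw [residuePart_dissection f]
    simp only [map_mul]
    ring
  rw [residuePart_of_eq hr h]
  interval_cases r <;> simp

theorem mul_dissection (f g : ℤ⟦X⟧) :
    f * g = expandThree (residuePart 0 f * residuePart 0 g +
        X * (residuePart 1 f * residuePart 2 g + residuePart 2 f * residuePart 1 g)) +
      X * expandThree (residuePart 0 f * residuePart 1 g + residuePart 1 f * residuePart 0 g +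
        X * (residuePart 2 f * residuePart 2 g)) +
      X ^ 2 * expandThree (residuePart 0 f * residuePart 2 g + residuePart 1 f * residuePart 1 g +
        residuePart 2 f * residuePart 0 g) := by
  conv_lhs => rw [residuePart_dissection f, residuePart_dissection g]
  simp only [map_mul, map_add, expand_X]
  ring

theorem residuePart_one {r : ℕ} (hr : r < 3) : residuePart r 1 = if r = 0 then 1 else 0 := by
  rw [← pow_zero X, residuePart_X_pow hr]
  simp [eq_comm]

/-! ### The cubic norm of ψ -/

/-- The norm `f(q) f(ωq) f(ω²q)` with `ω` a primitive cube root of unity, as a series in `q ^ 3`. -/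
noncomputable def cubicNorm : ℤ⟦X⟧ →* ℤ⟦X⟧ where
  toFun f := residuePart 0 f ^ 3 + X * residuePart 1 f ^ 3 + X ^ 2 * residuePart 2 f ^ 3 -
    3 * X * (residuePart 0 f * residuePart 1 f * residuePart 2 f)
  map_one' := by simp [residuePart_one]
  map_mul' f g := by
    have h := mul_dissection f g
    rw [residuePart_of_eq (r := 0) (by norm_num) h, residuePart_of_eq (r := 1) (by norm_num) h,
      residuePart_of_eq (r := 2) (by norm_num) h]
    simp only [if_true, one_ne_zero, OfNat.ofNat_ne_zero, OfNat.zero_ne_ofNat, zero_ne_one,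
      OfNat.one_ne_ofNat, OfNat.ofNat_ne_one, if_false, zero_add, add_zero]
    ring

theorem cubicNorm_apply (f : ℤ⟦X⟧) : cubicNorm f =
    residuePart 0 f ^ 3 + X * residuePart 1 f ^ 3 + X ^ 2 * residuePart 2 f ^ 3 -
      3 * X * (residuePart 0 f * residuePart 1 f * residuePart 2 f) := rfl

theorem continuous_cubicNorm : Continuous cubicNorm := by
  have h := continuous_residuePart
  change Continuous fun f => residuePart 0 f ^ 3 + X * residuePart 1 f ^ 3 +
    X ^ 2 * residuePart 2 f ^ 3 - 3 * X * (residuePart 0 f * residuePart 1 f * residuePart 2 f)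
  fun_prop

theorem cubicNorm_one_sub_X_pow_of_dvd {m : ℕ} (hm : 3 ∣ m) :
    cubicNorm (1 - X ^ m) = (1 - X ^ (m / 3)) ^ 3 := by
  have h : m % 3 = 0 := by omega
  simp [cubicNorm_apply, residuePart_one, residuePart_X_pow, h]

theorem cubicNorm_one_sub_X_pow_of_not_dvd {m : ℕ} (hm : ¬ 3 ∣ m) :
    cubicNorm (1 - X ^ m) = 1 - X ^ m := by
  rcases (by omega : m % 3 = 1 ∨ m % 3 = 2) with h | h
  · have h' : X ^ m = X * (X ^ (m / 3) : ℤ⟦X⟧) ^ 3 := by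
      rw [← pow_mul, ← pow_succ']; congr 1; omega
    simp only [cubicNorm_apply, residuePart_one, residuePart_X_pow, h, map_sub,
      Nat.lt_add_one, Nat.one_lt_ofNat, Nat.ofNat_pos]
    rw [h']
    simp
    ring
  · have h' : X ^ m = X ^ 2 * (X ^ (m / 3) : ℤ⟦X⟧) ^ 3 := by
      rw [← pow_mul, ← pow_add]; congr 1; omega
    simp only [cubicNorm_apply, residuePart_one, residuePart_X_pow, h, map_sub,
      Nat.lt_add_one, Nat.one_lt_ofNat, Nat.ofNat_pos]
    rw [h']
    simp
    ring

theorem hasProd_qPoch (a b : ℤ⟦X⟧) (hb : constantCoeff b = 0) :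
    HasProd (fun k : ℕ => 1 - a * b ^ k) (qPoch a b) :=
  (qPoch_multipliable a b hb).hasProd

theorem expandThree_qPoch (a b : ℤ⟦X⟧) (hb : constantCoeff b = 0) :
    expandThree (qPoch a b) = qPoch (expandThree a) (expandThree b) := by
  rw [qPoch, (qPoch_multipliable a b hb).map_tprod expandThree continuous_expandThree]
  simp [qPoch]

theorem expandThree_psi : expandThree (psi X) = psi (X ^ 3) := by
  rw [psi, (psi_summable X (by simp)).map_tsum expandThree continuous_expandThree]
  simp [psi]

/-- The norm fixes the factors 1 - q^m with 3 ∤ m, and the factors with 3 ∣ m together give the cube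
of the whole product. The missing factors with 3 ∣ m are exactly those of the product at q³. -/
theorem cubicNorm_qPoch_mul {s : ℕ} (hs : s = 1 ∨ s = 2) :
    cubicNorm (qPoch (X ^ s) (X ^ 2)) * expandThree (qPoch (X ^ s) (X ^ 2)) =
      qPoch (X ^ s) (X ^ 2) ^ 4 := by
  have hX : constantCoeff (X ^ 2 : ℤ⟦X⟧) = 0 := by simp
  have hM := hasProd_qPoch (X ^ s) (X ^ 2) hX
  have hM₃ := hasProd_qPoch (expandThree (X ^ s)) (expandThree (X ^ 2)) (by simp)
  set e : ℕ → ℕ := fun j => 3 * j + s with he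
  have hinj : Function.Injective e := fun i j h => by simp only [he] at h; omega
  have hdvd : ∀ k, k ∉ Set.range e → ¬ 3 ∣ s + 2 * k := fun k hk hd =>
    hk ⟨(k - s) / 3, by simp only [he]; omega⟩
  have hexp : ∀ j, s + 2 * e j = 3 * (s + 2 * j) := fun j => by simp only [he]; ring
  -- Padding with 1 off the indices k with 3 ∣ s + 2k lets the products be compared factor by
  -- factor.
  let w : ℕ → ℤ⟦X⟧ := Function.extend e (fun j => 1 - X ^ (3 * (s + 2 * j))) 1
  let z : ℕ → ℤ⟦X⟧ := Function.extend e (fun j => (1 - X ^ (s + 2 * j)) ^ 3) 1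
  have hwe : ∀ j, w (e j) = 1 - X ^ (3 * (s + 2 * j)) := fun j => hinj.extend_apply _ _ j
  have hze : ∀ j, z (e j) = (1 - X ^ (s + 2 * j)) ^ 3 := fun j => hinj.extend_apply _ _ j
  have hw₁ : ∀ k, k ∉ Set.range e → w k = 1 := fun k hk => Function.extend_apply' _ _ k hk
  have hz₁ : ∀ k, k ∉ Set.range e → z k = 1 := fun k hk => Function.extend_apply' _ _ k hk
  clear_value w z
  have hw : HasProd w (expandThree (qPoch (X ^ s) (X ^ 2))) := by
    rw [expandThree_qPoch _ _ hX]
    refine (hinj.hasProd_iff hw₁).1 ?_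
    convert hM₃ using 1
    funext j
    simp only [Function.comp_apply, hwe, map_pow, expand_X, ← pow_mul, ← pow_add]
    congr 2
    ring
  have hz : HasProd z (qPoch (X ^ s) (X ^ 2) ^ 3) := by
    refine (hinj.hasProd_iff hz₁).1 ?_
    convert hM.pow 3 using 1
    funext j
    simp only [Function.comp_apply, hze, ← pow_mul, ← pow_add]
  have hN : HasProd (fun k => cubicNorm (1 - X ^ s * (X ^ 2) ^ k))
      (cubicNorm (qPoch (X ^ s) (X ^ 2))) := hM.map cubicNorm continuous_cubicNorm
  rw [pow_succ' _ 3]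
  refine (hN.mul hw).unique ?_
  convert hM.mul hz using 1
  funext k
  rw [← pow_mul, ← pow_add]
  by_cases hk : k ∈ Set.range e
  · obtain ⟨j, rfl⟩ := hk
    rw [hwe, hze, hexp, cubicNorm_one_sub_X_pow_of_dvd (dvd_mul_right _ _),
      Nat.mul_div_cancel_left _ three_pos, mul_comm]
  · rw [cubicNorm_one_sub_X_pow_of_not_dvd (hdvd k hk), hw₁ k hk, hz₁ k hk]

theorem qPoch_ne_zero (a b : ℤ⟦X⟧) (ha : constantCoeff a = 0) (hb : constantCoeff b = 0) :
    qPoch a b ≠ 0 := fun h => by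
  have := qPoch_constantCoeff a b ha hb
  simp [h] at this

theorem cubicNorm_psi_mul : cubicNorm (psi X) * expandThree (psi X) = psi X ^ 4 := by
  have h₁ := cubicNorm_qPoch_mul (Or.inl rfl)
  have h₂ := cubicNorm_qPoch_mul (Or.inr rfl)
  rw [pow_one] at h₁
  rw [← psi_mul_qPoch, map_mul, map_mul, mul_pow, mul_mul_mul_comm, h₁] at h₂
  exact mul_right_cancel₀ (pow_ne_zero 4 (qPoch_ne_zero _ _ (by simp) (by simp))) h₂

/-! ### The 3-dissection of ψ -/

theorem triangle_mod_three (n : ℕ) :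
    n * (n + 1) / 2 % 3 = if n % 3 = 1 then 1 else 0 := by
  obtain ⟨k, rfl | rfl | rfl⟩ : ∃ k, n = 3 * k ∨ n = 3 * k + 1 ∨ n = 3 * k + 2 :=
    ⟨n / 3, by omega⟩
  all_goals
    obtain ⟨t, ht⟩ := Nat.even_mul_succ_self k
    ring_nf at ht ⊢
    split_ifs <;> omega

theorem residuePart_psi (r : ℕ) :
    residuePart r (psi X) = ∑' n : ℕ, residuePart r (X ^ (n * (n + 1) / 2)) :=
  (psi_summable X (by simp)).map_tsum _ (continuous_residuePart r)

theorem residuePart_two_psi : residuePart 2 (psi X) = 0 := by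
  rw [residuePart_psi]
  refine (tsum_congr fun n => ?_).trans tsum_zero
  rw [residuePart_X_pow (by norm_num), triangle_mod_three, if_neg (by split_ifs <;> norm_num)]

/-- Only n = 3k + 1 contributes, where the triangular number is 9·k(k+1)/2 + 1. -/
theorem residuePart_one_psi : residuePart 1 (psi X) = expandThree (psi X) := by
  rw [residuePart_psi, expandThree_psi, psi]
  have hinj : Function.Injective fun k : ℕ => 3 * k + 1 := fun i j h => by simpa using h
  rw [← hinj.tsum_eq]
  · refine tsum_congr fun k => ?_
    rw [residuePart_X_pow (by norm_num), triangle_mod_three, if_pos (by split_ifs <;> omega),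
      ← pow_mul]
    congr 1
    obtain ⟨t, ht⟩ := Nat.even_mul_succ_self k
    ring_nf at ht ⊢
    omega
  · intro n hn
    rw [Function.mem_support, residuePart_X_pow (by norm_num), triangle_mod_three] at hn
    have : n % 3 = 1 := by
      by_contra h
      simp [h] at hn
    exact ⟨n / 3, by simp only; omega⟩

theorem psi_dissection :
    psi X = expandThree (residuePart 0 (psi X)) + X * expandThree (expandThree (psi X)) := by
  conv_lhs => rw [residuePart_dissection (psi X), residuePart_one_psi, residuePart_two_psi]
  simp

/-- `A(q) ^ 3 + q ψ(q ^ 3) ^ 3 = ψ(q) ^ 4 / ψ(q ^ 3)`, with `A(q ^ 3) = ψ(q) - q ψ(q ^ 9)`. -/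
theorem residuePart_psi_cubic :
    (residuePart 0 (psi X) ^ 3 + X * expandThree (psi X) ^ 3) * expandThree (psi X) =
      psi X ^ 4 := by
  rw [← cubicNorm_psi_mul, cubicNorm_apply, residuePart_one_psi, residuePart_two_psi]
  ring

/-! ### Powers of 1/ψ modulo 9 -/

theorem seriesModEq_of_eq_add_mul {m : ℤ} {f g : ℤ⟦X⟧} (h : ℤ⟦X⟧) (hfg : f = g + C m * h) :
    SeriesModEq m f g := fun n => by
  rw [hfg, map_add, coeff_C_mul]
  exact (Int.modEq_iff_dvd.2 ⟨coeff n h, by ring⟩).symm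

namespace SeriesModEq
variable {m : ℤ} {f g h : ℤ⟦X⟧}

theorem trans (hfg : SeriesModEq m f g) (hgh : SeriesModEq m g h) : SeriesModEq m f h :=
  fun n => (hfg n).trans (hgh n)

theorem residuePart (r : ℕ) (hfg : SeriesModEq m f g) :
    SeriesModEq m (residuePart r f) (residuePart r g) := fun n => by
  simpa using hfg (3 * n + r)

theorem mul_left (h : ℤ⟦X⟧) (hfg : SeriesModEq m f g) : SeriesModEq m (h * f) (h * g) := fun n => by
  simp only [coeff_mul]
  exact Int.ModEq.sum fun p _ => (hfg p.2).mul_left _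

end SeriesModEq

theorem psi_mul_recip : psi X * recip (psi X) = 1 :=
  mul_recip _ (psi_constantCoeff X (by simp))

/-- The `3`-dissection of `1 / ψ(q)`. -/
theorem recip_psi_dissection : ∃ a b F ρ : ℤ⟦X⟧, b = expandThree (psi X) ∧
    F = a ^ 3 + X * b ^ 3 ∧ F * ρ = 1 ∧ ρ = b * recip (psi X) ^ 4 ∧
    recip (psi X) = expandThree ρ * (expandThree (a ^ 2) - X * expandThree (a * b) +
      X ^ 2 * expandThree (b ^ 2)) := by
  have hFρ : (residuePart 0 (psi X) ^ 3 + X * expandThree (psi X) ^ 3) *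
      (expandThree (psi X) * recip (psi X) ^ 4) = 1 := by
    rw [← mul_assoc, residuePart_psi_cubic, ← mul_pow, psi_mul_recip, one_pow]
  refine ⟨residuePart 0 (psi X), _, _, _, rfl, rfl, hFρ, rfl, ?_⟩
  have h := congrArg expandThree hFρ
  rw [map_mul, map_one] at h
  have hψ := psi_mul_recip
  have hd := psi_dissection
  generalize expandThree (expandThree (psi X) * recip (psi X) ^ 4) = σ at *
  simp only [map_mul, map_pow, map_add, expand_X] at *
  generalize expandThree (residuePart 0 (psi X)) = x at *
  generalize expandThree (expandThree (psi X)) = y at *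
  generalize recip (psi X) = R at *
  -- This is x³ + (qy)³ = (x + qy)(x² - qxy + q²y²), with σ inverting the left side and R inverting
  -- x + qy.
  linear_combination -R * h + σ * (x ^ 2 - X * (x * y) + X ^ 2 * y ^ 2) * (hψ - R * hd)

theorem residuePart_zero_recip_psi_pow_three :
    SeriesModEq 9 (residuePart 0 (recip (psi X) ^ 3))
      (expandThree (psi X) * recip (psi X) ^ 4) := by
  obtain ⟨a, b, F, ρ, hb, hF, hFρ, hρ, hR⟩ := recip_psi_dissection
  have h : recip (psi X) ^ 3 = expandThree (ρ ^ 3) * (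
      expandThree
        (a ^ 6 - 7 * X * a ^ 3 * b ^ 3 + X ^ 2 * b ^ 6) +
      X * expandThree
        (-3 * a ^ 5 * b + 6 * X * a ^ 2 * b ^ 4) +
      X ^ 2 * expandThree
        (6 * a ^ 4 * b ^ 2 - 3 * X * a * b ^ 5)) := by
    rw [hR]
    simp only [map_add, map_sub, map_neg, map_mul, map_pow, map_ofNat, expand_X]
    ring
  rw [h, residuePart_expandThree_mul (by norm_num), residuePart_of_eq (by norm_num) rfl]
  -- As -7 ≡ 2, the form is F² modulo 9; the witness is ρ³ times the exact quotient by 9 of its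
  -- difference from F². The lemmas for powers 4, 7, 8 work alike with F², F⁴, F⁵.
  refine seriesModEq_of_eq_add_mul
    (ρ ^ 3 * (-X * a ^ 3 * b ^ 3)) ?_
  have hF' : F ^ 2 * ρ ^ 2 = 1 := by rw [← mul_pow, hFρ, one_pow]
  rw [← hb, map_ofNat C]
  norm_num only [if_true, if_false, zero_add, add_zero]
  rw [hF] at hF'
  rw [hρ] at hF' ⊢
  linear_combination b ^ 1 * recip (psi X) ^ 4 * hF'

theorem residuePart_two_recip_psi_pow_four :
    SeriesModEq 9 (residuePart 2 (recip (psi X) ^ 4))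
      (expandThree (psi X) ^ 4 * recip (psi X) ^ 8) := by
  obtain ⟨a, b, F, ρ, hb, hF, hFρ, hρ, hR⟩ := recip_psi_dissection
  have h : recip (psi X) ^ 4 = expandThree (ρ ^ 4) * (
      expandThree
        (a ^ 8 - 16 * X * a ^ 5 * b ^ 3 + 10 * X ^ 2 * a ^ 2 * b ^ 6) +
      X * expandThree
        (-4 * a ^ 7 * b + 19 * X * a ^ 4 * b ^ 4 - 4 * X ^ 2 * a * b ^ 7) +
      X ^ 2 * expandThree
        (10 * a ^ 6 * b ^ 2 - 16 * X * a ^ 3 * b ^ 5 + X ^ 2 * b ^ 8)) := by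
    rw [hR]
    simp only [map_add, map_sub, map_neg, map_mul, map_pow, map_ofNat, expand_X]
    ring
  rw [h, residuePart_expandThree_mul (by norm_num), residuePart_of_eq (by norm_num) rfl]
  refine seriesModEq_of_eq_add_mul
    (ρ ^ 4 * (a ^ 6 * b ^ 2 - 2 * X * a ^ 3 * b ^ 5)) ?_
  have hF' : F ^ 2 * ρ ^ 2 = 1 := by rw [← mul_pow, hFρ, one_pow]
  rw [← hb, map_ofNat C]
  norm_num only [if_true, if_false, zero_add, add_zero]
  rw [hF] at hF'
  rw [hρ] at hF' ⊢
  linear_combination b ^ 4 * recip (psi X) ^ 8 * hF'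

theorem residuePart_two_recip_psi_pow_seven :
    SeriesModEq 9 (residuePart 2 (recip (psi X) ^ 7))
      (expandThree (psi X) ^ 5 * recip (psi X) ^ 12) := by
  obtain ⟨a, b, F, ρ, hb, hF, hFρ, hρ, hR⟩ := recip_psi_dissection
  have h : recip (psi X) ^ 7 = expandThree (ρ ^ 7) * (
      expandThree
        (a ^ 14 - 77 * X * a ^ 11 * b ^ 3 + 357 * X ^ 2 * a ^ 8 * b ^ 6 -
        266 * X ^ 3 * a ^ 5 * b ^ 9 + 28 * X ^ 4 * a ^ 2 * b ^ 12) +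
      X * expandThree
        (-7 * a ^ 13 * b + 161 * X * a ^ 10 * b ^ 4 - 393 * X ^ 2 * a ^ 7 * b ^ 7 +
        161 * X ^ 3 * a ^ 4 * b ^ 10 - 7 * X ^ 4 * a * b ^ 13) +
      X ^ 2 * expandThree
        (28 * a ^ 12 * b ^ 2 - 266 * X * a ^ 9 * b ^ 5 + 357 * X ^ 2 * a ^ 6 * b ^ 8 -
        77 * X ^ 3 * a ^ 3 * b ^ 11 + X ^ 4 * b ^ 14)) := by
    rw [hR]
    simp only [map_add, map_sub, map_neg, map_mul, map_pow, map_ofNat, expand_X]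
    ring
  rw [h, residuePart_expandThree_mul (by norm_num), residuePart_of_eq (by norm_num) rfl]
  refine seriesModEq_of_eq_add_mul
    (ρ ^ 7 * (3 * a ^ 12 * b ^ 2 - 30 * X * a ^ 9 * b ^ 5 + 39 * X ^ 2 * a ^ 6 * b ^ 8 -
        9 * X ^ 3 * a ^ 3 * b ^ 11)) ?_
  have hF' : F ^ 4 * ρ ^ 4 = 1 := by rw [← mul_pow, hFρ, one_pow]
  rw [← hb, map_ofNat C]
  norm_num only [if_true, if_false, zero_add, add_zero]
  rw [hF] at hF'
  rw [hρ] at hF' ⊢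
  linear_combination b ^ 5 * recip (psi X) ^ 12 * hF'

theorem residuePart_one_recip_psi_pow_eight :
    SeriesModEq 9 (residuePart 1 (recip (psi X) ^ 8))
      (expandThree (psi X) ^ 4 * recip (psi X) ^ 12) := by
  obtain ⟨a, b, F, ρ, hb, hF, hFρ, hρ, hR⟩ := recip_psi_dissection
  have h : recip (psi X) ^ 8 = expandThree (ρ ^ 8) * (
      expandThree
        (a ^ 16 - 112 * X * a ^ 13 * b ^ 3 + 784 * X ^ 2 * a ^ 10 * b ^ 6 -
        1016 * X ^ 3 * a ^ 7 * b ^ 9 + 266 * X ^ 4 * a ^ 4 * b ^ 12 -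
        8 * X ^ 5 * a * b ^ 15) +
      X * expandThree
        (-8 * a ^ 15 * b + 266 * X * a ^ 12 * b ^ 4 - 1016 * X ^ 2 * a ^ 9 * b ^ 7 +
        784 * X ^ 3 * a ^ 6 * b ^ 10 - 112 * X ^ 4 * a ^ 3 * b ^ 13 +
        X ^ 5 * b ^ 16) +
      X ^ 2 * expandThree
        (36 * a ^ 14 * b ^ 2 - 504 * X * a ^ 11 * b ^ 5 + 1107 * X ^ 2 * a ^ 8 * b ^ 8 -
        504 * X ^ 3 * a ^ 5 * b ^ 11 + 36 * X ^ 4 * a ^ 2 * b ^ 14)) := by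
    rw [hR]
    simp only [map_add, map_sub, map_neg, map_mul, map_pow, map_ofNat, expand_X]
    ring
  rw [h, residuePart_expandThree_mul (by norm_num), residuePart_of_eq (by norm_num) rfl]
  refine seriesModEq_of_eq_add_mul
    (ρ ^ 8 * (-a ^ 15 * b + 29 * X * a ^ 12 * b ^ 4 - 114 * X ^ 2 * a ^ 9 * b ^ 7 +
        86 * X ^ 3 * a ^ 6 * b ^ 10 - 13 * X ^ 4 * a ^ 3 * b ^ 13)) ?_
  have hF' : F ^ 5 * ρ ^ 5 = 1 := by rw [← mul_pow, hFρ, one_pow]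
  rw [← hb, map_ofNat C]
  norm_num only [if_true, if_false, zero_add, add_zero]
  rw [hF] at hF'
  rw [hρ] at hF' ⊢
  linear_combination b ^ 4 * recip (psi X) ^ 12 * hF'

/-! ### Iteration along the progressions -/

theorem psi_pow_mul_recip_psi_pow {j k l : ℕ} (hjk : j + k = l) (f : ℤ⟦X⟧) :
    psi X ^ j * (f * recip (psi X) ^ l) = f * recip (psi X) ^ k := by
  rw [← hjk, pow_add, show psi X ^ j * (f * (recip (psi X) ^ j * recip (psi X) ^ k)) =
    (psi X * recip (psi X)) ^ j * (f * recip (psi X) ^ k) by ring, psi_mul_recip, one_pow, one_mul]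

theorem residuePart_expandThree_mul_modEq {r j k l : ℕ} (hr : r < 3) (hjk : j + k = l) (i n : ℕ)
    (h : SeriesModEq 9 (residuePart r (recip (psi X) ^ n))
      (expandThree (psi X) ^ i * recip (psi X) ^ l)) :
    SeriesModEq 9 (residuePart r (expandThree (psi X) ^ j * recip (psi X) ^ n))
      (expandThree (psi X) ^ i * recip (psi X) ^ k) := by
  rw [← map_pow, residuePart_expandThree_mul hr, ← psi_pow_mul_recip_psi_pow hjk]
  exact h.mul_left _

/-- The offsets become 5k + 1 and 21k + 3, both of the parity of α + 1; this produces the sign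
(-1)^(α-1). -/
theorem exists_three_pow_two_mul (α : ℕ) : ∃ k, 3 ^ (2 * α) = 8 * k + 1 ∧ Even (k + α) := by
  induction α with
  | zero => exact ⟨0, by simp⟩
  | succ α ih =>
    obtain ⟨k, hk, h⟩ := ih
    refine ⟨9 * k + 1, by rw [mul_add, pow_add, hk]; ring, ?_⟩
    rw [Nat.even_iff] at h ⊢
    omega

theorem residuePart_mk_coeff (r : ℕ) (e : ℕ → ℕ) (f : ℤ⟦X⟧) :
    residuePart r (mk fun n => coeff (e n) f) = mk fun n => coeff (e (3 * n + r)) f := by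
  ext n
  simp

theorem odd_subprogression (α : ℕ) (f : ℤ⟦X⟧) :
    residuePart 2 (mk fun n => coeff (3 ^ (2 * α) * n + (5 * 3 ^ (2 * α) + 3) / 8) f) =
      mk fun n => coeff (3 ^ (2 * α + 1) * n + (7 * 3 ^ (2 * α + 1) + 3) / 8) f := by
  rw [residuePart_mk_coeff]
  congr 1
  funext n
  congr 2
  obtain ⟨k, hk, -⟩ := exists_three_pow_two_mul α
  rw [pow_succ, hk, show (5 * (8 * k + 1) + 3) / 8 = 5 * k + 1 by omega,
    show (7 * ((8 * k + 1) * 3) + 3) / 8 = 21 * k + 3 by omega]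
  ring

theorem even_subprogression (α : ℕ) (f : ℤ⟦X⟧) :
    residuePart 1 (mk fun n => coeff (3 ^ (2 * α + 1) * n + (7 * 3 ^ (2 * α + 1) + 3) / 8) f) =
      mk fun n => coeff (3 ^ (2 * (α + 1)) * n + (5 * 3 ^ (2 * (α + 1)) + 3) / 8) f := by
  rw [residuePart_mk_coeff]
  congr 1
  funext n
  congr 2
  obtain ⟨k, hk, -⟩ := exists_three_pow_two_mul α
  rw [show 2 * (α + 1) = 2 * α + 1 + 1 by ring, pow_succ _ (2 * α + 1), pow_succ _ (2 * α), hk,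
    show (7 * ((8 * k + 1) * 3) + 3) / 8 = 21 * k + 3 by omega,
    show (5 * ((8 * k + 1) * 3 * 3) + 3) / 8 = 45 * k + 6 by omega]
  ring

theorem odd_progression_of_even {α : ℕ}
    (h : SeriesModEq 9 (mk fun n => coeff (3 ^ (2 * α) * n + (5 * 3 ^ (2 * α) + 3) / 8)
      (recip (psi X) ^ 3)) (expandThree (psi X) ^ 4 * recip (psi X) ^ 7)) :
    SeriesModEq 9 (mk fun n => coeff (3 ^ (2 * α + 1) * n + (7 * 3 ^ (2 * α + 1) + 3) / 8)
      (recip (psi X) ^ 3)) (expandThree (psi X) ^ 5 * recip (psi X) ^ 8) := by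
  rw [← odd_subprogression]
  exact (h.residuePart 2).trans (residuePart_expandThree_mul_modEq (by norm_num) rfl _ _
    residuePart_two_recip_psi_pow_seven)

theorem recip_psi_cube_even_progression (α : ℕ) :
    SeriesModEq 9 (mk fun n => coeff (3 ^ (2 * (α + 1)) * n + (5 * 3 ^ (2 * (α + 1)) + 3) / 8)
      (recip (psi X) ^ 3)) (expandThree (psi X) ^ 4 * recip (psi X) ^ 7) := by
  induction α with
  | zero =>
    have h₃ : SeriesModEq 9 (residuePart 0 (recip (psi X) ^ 3))
        (expandThree (psi X) ^ 1 * recip (psi X) ^ 4) := by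
      simpa using residuePart_zero_recip_psi_pow_three
    have h := (h₃.residuePart 2).trans
      (residuePart_expandThree_mul_modEq (j := 1) (k := 7) (i := 4) (n := 4) (by norm_num) rfl
        residuePart_two_recip_psi_pow_four)
    intro n
    convert h n using 1
    simp only [coeff_residuePart, coeff_mk]
    congr 2
    omega
  | succ α ih =>
    rw [← even_subprogression]
    exact ((odd_progression_of_even ih).residuePart 1).trans
      (residuePart_expandThree_mul_modEq (by norm_num) rfl _ _
        residuePart_one_recip_psi_pow_eight)

/-! ### The substitution q ↦ -q and the signs -/

theorem continuous_evalNegHom : Continuous (evalNegHom : ℤ⟦X⟧ →+* ℤ⟦X⟧) :=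
  continuous_of_continuous_coeff fun n => by
    simp only [evalNegHom, coeff_rescale]
    exact (WithPiTopology.continuous_coeff ℤ n).const_mul _

theorem evalNegHom_qPoch (a b : ℤ⟦X⟧) (hb : constantCoeff b = 0) :
    evalNegHom (qPoch a b) = qPoch (evalNegHom a) (evalNegHom b) := by
  rw [qPoch, (qPoch_multipliable a b hb).map_tprod evalNegHom continuous_evalNegHom]
  simp [qPoch]

theorem eq_recip_of_mul_eq_one {f g : ℤ⟦X⟧} (h : f * g = 1) (hf : constantCoeff f = 1) :
    recip f = g := by
  rw [← mul_one (recip f), ← h, ← mul_assoc, mul_comm (recip f), mul_recip f hf, one_mul]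

theorem recip_psi_pow (k : ℕ) : recip (psi X ^ k) = recip (psi X) ^ k :=
  eq_recip_of_mul_eq_one (by rw [← mul_pow, psi_mul_recip, one_pow])
    (by rw [map_pow, psi_constantCoeff X (by simp), one_pow])

/-- The generating function of `(-1) ^ n * pod₋ₖ(n)` is `1 / ψ(q) ^ k`. -/
theorem neg_one_pow_mul_podNeg (k n : ℕ) :
    (-1) ^ n * podNeg k n = coeff n (recip (psi X) ^ k) := by
  have hc : constantCoeff (qPoch (X ^ 2) (X ^ 2) ^ k : ℤ⟦X⟧) = 1 := by
    rw [map_pow, qPoch_constantCoeff _ _ (by simp) (by simp), one_pow]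
  have h := congrArg evalNegHom (mul_recip _ hc)
  rw [map_mul, map_pow, evalNegHom_qPoch _ _ (by simp), map_pow, evalNegHom_X, neg_sq,
    map_one] at h
  rw [podNeg, ← coeff_rescale]
  change coeff n (evalNegHom _) = _
  rw [map_mul, map_pow, evalNegHom_qPoch _ _ (by simp), map_pow, map_neg, evalNegHom_X, neg_neg,
    neg_sq]
  rw [← psi_mul_qPoch] at h ⊢
  generalize evalNegHom (recip _) = s at h ⊢
  have hψ : psi X ^ k * recip (psi X) ^ k = 1 := by rw [← mul_pow, psi_mul_recip, one_pow]
  congr 1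
  rw [mul_pow] at h
  linear_combination recip (psi X) ^ k * h - qPoch X (X ^ 2) ^ k * s * hψ

theorem neg_one_pow_mul_podNeg_progression {k N c j : ℕ} (hN : Odd N) (hc : Even (c + j))
    (n : ℕ) : (-1) ^ n * podNeg k (N * n + c) =
      (-1) ^ j * coeff (N * n + c) (recip (psi X) ^ k) := by
  rw [← neg_one_pow_mul_podNeg, ← mul_assoc, ← pow_add, pow_add, pow_add, pow_mul, hN.neg_one_pow,
    mul_left_comm, ← pow_add, add_comm j, hc.neg_one_pow, mul_one]

theorem seriesModEq_podNeg_progression {k N c j : ℕ} {m : ℤ} {g : ℤ⟦X⟧} (hN : Odd N)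
    (hc : Even (c + j))
    (h : SeriesModEq m (mk fun n => coeff (N * n + c) (recip (psi X) ^ k)) g) :
    SeriesModEq m (mk fun n => (-1) ^ n * podNeg k (N * n + c)) ((-1) ^ j * g) := by
  intro n
  have hC : ((-1) ^ j : ℤ⟦X⟧) = C ((-1) ^ j) := by simp
  rw [coeff_mk, neg_one_pow_mul_podNeg_progression hN hc, hC, coeff_C_mul]
  simpa using (h n).mul_left ((-1) ^ j)

theorem theorem2p3 (α : ℕ) (hα : 1 ≤ α) :
    SeriesModEq 9
      (PowerSeries.mk fun n : ℕ =>
        (-1) ^ n * podNeg 3 (3 ^ (2 * α) * n + (5 * 3 ^ (2 * α) + 3) / 8))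
      ((-1) ^ (α - 1) * (psi (PowerSeries.X ^ 3) ^ 4 * recip (psi PowerSeries.X ^ 7))) ∧
    SeriesModEq 9
      (PowerSeries.mk fun n : ℕ =>
        (-1) ^ n * podNeg 3 (3 ^ (2 * α + 1) * n + (7 * 3 ^ (2 * α + 1) + 3) / 8))
      ((-1) ^ (α - 1) * (psi (PowerSeries.X ^ 3) ^ 5 * recip (psi PowerSeries.X ^ 8))) := by
  obtain ⟨β, rfl⟩ : ∃ β, α = β + 1 := ⟨α - 1, by omega⟩
  rw [← expandThree_psi, recip_psi_pow, recip_psi_pow, Nat.add_sub_cancel]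
  obtain ⟨k, hk, hk'⟩ := exists_three_pow_two_mul (β + 1)
  have h := recip_psi_cube_even_progression β
  rw [Nat.even_iff] at hk'
  refine ⟨seriesModEq_podNeg_progression (Odd.pow (by decide)) ?_ h,
    seriesModEq_podNeg_progression (Odd.pow (by decide)) ?_ (odd_progression_of_even h)⟩
  · rw [hk, Nat.even_iff]
    omega
  · rw [pow_succ, hk, Nat.even_iff]
    omega
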